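/- **Setting.** A *metric measure space* $(M,\mathsf d,\mathfrak m)$ is a complete separable geodesic metric space with a $\sigma$-finite Borel measure $\mathfrak m$ of full support. $\mathrm{Geo}(M)$ is the set of $\gamma\in C([0,1],M)$ with $\mathsf d(\gamma_s,\gamma_t)=|s-t|\,\mathsf d(\gamma_0,\gamma_1)$ for all $s,t$, with the uniform topology, and $e_t(\gamma)=\gamma_t$. $\mathcal P_2(M)$ is the set of Borel probability measures with finite second moment, with the Wasserstein distance $W_2(\mu,\nu)^2=\inf_\pi\int \mathsf d^2\,d\pi$ (infimum over couplings), and $\mathcal P_2^{ac}(M)=\{\mu\in\mathcal P_2(M):\mu\ll\mathfrak m\}$. A *$W_2$-geodesic* is a family $(\mu_t)_{t\in[0,1]}\subset\mathcal P_2(M)$ with $W_2(\mu_s,\mu_t)=|s-t|\,W_2(\mu_0,\mu_1)$ for all $s,t$. An *optimal coupling induced by* $(\mu_t)$ is an optimal coupling of $(\mu_0,\mu_1)$ of the form $(e_0,e_1)_\sharp\Pi$ with a Borel probability measure $\Pi$ on $\mathrm{Geo}(M)$ such that $(e_t)_\sharp\Pi=\mu_t$ for all $t$. For $K\in\mathbb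 R$, $N\ge 0$, $t\in[0,1]$, $\theta\ge0$ let $\sigma_{K,N}^{(t)}(\theta)$ be $t$ if $K\theta^2=0$, or if $K\theta^2<0$ and $N=0$; and otherwise $\infty$ if $K\theta^2\ge N\pi^2$; $\frac{\sin(t\theta\sqrt{K/N})}{\sin(\theta\sqrt{K/N})}$ if $0<K\theta^2<N\pi^2$; $\frac{\sinh(t\theta\sqrt{-K/N})}{\sinh(\theta\sqrt{-K/N})}$ if $K\theta^2<0$ and $N>0$. For $N\ge1$ let $\tau_{K,N}^{(t)}(\theta)=t^{1/N}\sigma_{K,N-1}^{(t)}(\theta)^{(N-1)/N}$, read as $\infty$ whenever $\sigma_{K,N-1}^{(t)}(\theta)=\infty$ (also when $t=0$ or $N=1$). Let $K\in\mathbb R$ and $N\in[1,\infty)$. The space satisfies the *strong $\mathsf{CD}(K,N)$-condition* if, for every $W_2$-geodesic $(\mu_t)$ with $\mu_0,\mu_1\in\mathcal P_2^{ac}(M)$, all $\mu_t=\rho_t\mathfrak m$ are absolutely continuous and $$\int_{\{\rho_t>0\}}\rho_t^{1-\frac1{N'}}\,d\mathfrak m\ \ge\ \int_{M\times M}\Big[\tau_{K,N'}^{(1-t)}(\mathsf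 d(x,y))\,\rho_0(x)^{-\frac1{N'}}+\tau_{K,N'}^{(t)}(\mathsf d(x,y))\,\rho_1(y)^{-\frac1{N'}}\Big]d\pi(x,y)$$ for all $t\in[0,1]$, all $N'\in[N,\infty)$ and every optimal coupling $\pi$ induced by $(\mu_t)$. The *strong $\mathsf{CD}^*(K,N)$-condition* is the same with $\sigma_{K,N'}$ in place of $\tau_{K,N'}$. For a probability measure $\mu=\rho\,\mathfrak m\ll\mathfrak m$ such that the positive part of $\rho\log\rho$ is $\mathfrak m$-integrable, put $\mathrm{Ent}_{\mathfrak m}(\mu)=\int\rho\log\rho\,d\mathfrak m\in[-\infty,\infty)$; put $\mathrm{Ent}_{\mathfrak m}(\mu)=+\infty$ for all other $\mu$. The space satisfies the *strong $\mathsf{CD}(K,\infty)$-condition* if for every $W_2$-geodesic $(\mu_t)$ with $\mu_0,\mu_1\in\mathcal P_2^{ac}(M)$ and every $t\in[0,1]$ $$\mathrm{Ent}_{\mathfrak m}(\mu_t)\le(1-t)\,\mathrm{Ent}_{\mathfrak m}(\mu_0)+t\,\mathrm{Ent}_{\mathfrak m}(\mu_1)-\tfrac K2\,t(1-t)\,W_2(\mu_0,\mu_1)^2,$$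 where nothing is required if $\mathrm{Ent}_{\mathfrak m}(\mu_0)$ or $\mathrm{Ent}_{\mathfrak m}(\mu_1)$ is $+\infty$. **Theorem.** Let $\mathsf G$ be a compact topological group (for instance a compact Lie group) acting on a metric measure space $(M,\mathsf d,\mathfrak m)$ by measure-preserving isometries such that $g\mapsto gx$ is continuous for every $x\in M$. Let $M^*=M/\mathsf G$ be the orbit space, $\mathsf p:M\to M^*$ the projection, $\mathsf d^*(\mathsf p(x),\mathsf p(y))=\inf_{g\in\mathsf G}\mathsf d(gx,y)$ and $\mathfrak m^*=\mathsf p_\sharp\mathfrak m$. Let $K\in\mathbb R$ and $N\in[1,\infty)$. Then $(M^*,\mathsf d^*,\mathfrak m^*)$ is a metric measure space, and if $(M,\mathsf d,\mathfrak m)$ satisfies the strong $\mathsf{CD}(K,N)$-condition (respectively the strong $\mathsf{CD}^*(K,N)$-condition, the strong $\mathsf{CD}(K,\infty)$-condition), then $(M^*,\mathsf d^*,\mathfrak m^*)$ satisfies the strong $\mathsf{CD}(K,N)$-condition (respectively the strong $\mathsf{CD}^*(K,N)$-condition, the strong $\mathsf{CD}(K,\infty)$-condition). -/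

import Mathlib

open MeasureTheory Set
open scoped ENNReal unitInterval

noncomputable section

namespace QuotCD

/-! ### Metric measure spaces -/

section MetricMeasure

variable {X : Type*} [MetricSpace X]

/-- `Geo(X)`: constant speed geodesics parametrised on `[0,1]`, with the topology of uniform
convergence (the compact-open topology of `C(I, X)`). -/
def Geo (X : Type*) [MetricSpace X] : Type _ :=
  {γ : C(I, X) // ∀ s t : I, dist (γ s) (γ t) = |(s : ℝ) - t| * dist (γ 0) (γ 1)}

instance : TopologicalSpace (Geo X) :=
  inferInstanceAs (TopologicalSpace
    {γ : C(I, X) // ∀ s t : I, dist (γ s) (γ t) = |(s : ℝ) - t| * dist (γ 0) (γ 1)})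

instance : MeasurableSpace (Geo X) := borel _

instance : BorelSpace (Geo X) := ⟨rfl⟩

/-- The evaluation map `e_t : Geo(X) → X`. -/
def Geo.eval (t : I) (γ : Geo X) : X := γ.1 t

/-- Complete separable geodesic metric measure spaces with a `σ`-finite measure of full support.
(That the `σ`-algebra is the Borel one is expressed by the class `BorelSpace`.) -/
structure IsMMSpace [MeasurableSpace X] (m : Measure X) : Prop where
  complete : CompleteSpace X
  separable : TopologicalSpace.SeparableSpace X
  geodesic : ∀ x y : X, ∃ γ : Geo X, γ.eval 0 = x ∧ γ.eval 1 = y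
  sigmaFinite : SigmaFinite m
  fullSupport : m.IsOpenPosMeasure

/-! ### Optimal transport -/

variable [MeasurableSpace X]

/-- `μ ∈ 𝒫₂(X)`. -/
structure MemP2 (μ : Measure X) : Prop where
  prob : IsProbabilityMeasure μ
  moment : ∃ x₀ : X, ∫⁻ x, edist x x₀ ^ 2 ∂μ < ∞

/-- `μ ∈ 𝒫₂ᵃᶜ(X, d, m)`. -/
def MemP2ac (m μ : Measure X) : Prop := MemP2 μ ∧ μ ≪ m

/-- `π` has first marginal `μ` and second marginal `ν`. -/
def IsCoupling (π : Measure (X × X)) (μ ν : Measure X) : Prop :=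
  π.map Prod.fst = μ ∧ π.map Prod.snd = ν

/-- The quadratic transport cost of a plan. -/
def cost (π : Measure (X × X)) : ℝ≥0∞ := ∫⁻ z, edist z.1 z.2 ^ 2 ∂π

/-- The `L²`-Wasserstein distance. -/
def W2 (μ ν : Measure X) : ℝ≥0∞ :=
  (⨅ π ∈ {π : Measure (X × X) | IsCoupling π μ ν}, cost π) ^ (1 / 2 : ℝ)

/-- `π` is an optimal coupling of `μ` and `ν`: a coupling that attains the minimal cost. -/
def IsOptimalCoupling (π : Measure (X × X)) (μ ν : Measure X) : Prop :=
  IsCoupling π μ ν ∧ ∀ π' : Measure (X × X), IsCoupling π' μ ν → cost π ≤ cost π'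

/-- `(μ_t)` is a (constant speed) geodesic of `(𝒫₂(X), W₂)`. -/
structure IsW2Geodesic (μ : I → Measure X) : Prop where
  memP2 : ∀ t, MemP2 (μ t)
  geodesic : ∀ s t : I,
    W2 (μ s) (μ t) = ENNReal.ofReal |(s : ℝ) - t| * W2 (μ 0) (μ 1)

/-- `π` is an optimal coupling induced by `(μ_t)`: there is an optimal dynamical plan `Π`, a
probability measure on `Geo(X)` with `(e_t)_♯ Π = μ_t` for all `t`, such that
`π = (e₀, e₁)_♯ Π`, and `π` is optimal. -/
def IsInducedCoupling (μ : I → Measure X) (π : Measure (X × X)) : Prop :=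
  ∃ P : Measure (Geo X), IsProbabilityMeasure P ∧
    (∀ t : I, P.map (Geo.eval t) = μ t) ∧
    π = P.map (fun γ => (γ.eval 0, γ.eval 1)) ∧
    IsOptimalCoupling π (μ 0) (μ 1)

end MetricMeasure

/-! ### Distortion coefficients -/

/-- `σ_{K,N}^{(t)}(θ)`, for `N ≥ 0`, `t ∈ [0,1]`, `θ ≥ 0`. -/
def sigmaCoeff (K N t θ : ℝ) : ℝ≥0∞ :=
  if K * θ ^ 2 = 0 ∨ (K * θ ^ 2 < 0 ∧ N = 0) then ENNReal.ofReal t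
  else if N * Real.pi ^ 2 ≤ K * θ ^ 2 then ∞
  else if 0 < K * θ ^ 2 then
    ENNReal.ofReal (Real.sin (t * θ * √(K / N)) / Real.sin (θ * √(K / N)))
  else
    ENNReal.ofReal (Real.sinh (t * θ * √(-K / N)) / Real.sinh (θ * √(-K / N)))

/-- `τ_{K,N}^{(t)}(θ) = t^{1/N} σ_{K,N-1}^{(t)}(θ)^{(N-1)/N}`, for `N ≥ 1`, `t ∈ [0,1]`, `θ ≥ 0`;
it is `∞` wherever `σ_{K,N-1}^{(t)}(θ)` is, also for `t = 0` and for `N = 1`. -/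
def tauCoeff (K N t θ : ℝ) : ℝ≥0∞ :=
  if sigmaCoeff K (N - 1) t θ = ∞ then ∞
  else ENNReal.ofReal t ^ (1 / N) * sigmaCoeff K (N - 1) t θ ^ ((N - 1) / N)

/-! ### Strong curvature-dimension conditions -/

section CurvatureDimension

variable {X : Type*} [MetricSpace X] [MeasurableSpace X]

/-- `∫ ρ^{1-1/N'} dm`, where `μ = ρ m`. The integral is over `{ρ > 0}`, which only matters for
`N' = 1`: then its value is `m {ρ > 0}`. -/
def renyi (m μ : Measure X) (N' : ℝ) : ℝ≥0∞ :=
  ∫⁻ x in {x | μ.rnDeriv m x ≠ 0}, μ.rnDeriv m x ^ (1 - 1 / N') ∂m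

/-- The finite dimensional strong condition with distortion coefficients `β N' t θ`: every
`W₂`-geodesic `(μ_t)` with `μ₀, μ₁ ∈ 𝒫₂ᵃᶜ` consists of absolutely continuous measures
`μ_t = ρ_t m`, and
`∫ ρ_t^{1-1/N'} dm ≥ ∫ β N' (1-t) (d(x,y)) ρ₀(x)^{-1/N'} + β N' t (d(x,y)) ρ₁(y)^{-1/N'} dπ(x,y)`
for all `t ∈ [0,1]`, `N' ∈ [N,∞)` and every optimal coupling `π` induced by `(μ_t)`. -/
def StrongDistortion (m : Measure X) (N : ℝ) (β : ℝ → ℝ → ℝ → ℝ≥0∞) : Prop :=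
  ∀ μ : I → Measure X, IsW2Geodesic μ → MemP2ac m (μ 0) → MemP2ac m (μ 1) →
    (∀ t, MemP2ac m (μ t)) ∧
    ∀ π : Measure (X × X), IsInducedCoupling μ π →
      ∀ (t : I) (N' : ℝ), N ≤ N' →
        ∫⁻ z, (β N' (1 - t) (dist z.1 z.2) * (μ 0).rnDeriv m z.1 ^ (-(1 / N')) +
            β N' t (dist z.1 z.2) * (μ 1).rnDeriv m z.2 ^ (-(1 / N'))) ∂π
          ≤ renyi m (μ t) N'

/-- The strong `CD(K,N)` condition, `N ∈ [1,∞)`. -/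
def StrongCD (m : Measure X) (K N : ℝ) : Prop :=
  StrongDistortion m N (tauCoeff K)

/-- The strong `CD*(K,N)` condition, `N ∈ [1,∞)`. -/
def StrongCDStar (m : Measure X) (K N : ℝ) : Prop :=
  StrongDistortion m N (sigmaCoeff K)

/-- `ρ log ρ`, where `μ = ρ m`. -/
def entDensity (m μ : Measure X) (x : X) : ℝ :=
  (μ.rnDeriv m x).toReal * Real.log (μ.rnDeriv m x).toReal

open Classical in
/-- The relative entropy: `∫ ρ log ρ dm ∈ [-∞,∞)` if `μ = ρ m ≪ m` and the positive part of
`ρ log ρ` is integrable, and `∞` otherwise. -/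
def Ent (m μ : Measure X) : EReal :=
  if μ ≪ m ∧ ∫⁻ x, ENNReal.ofReal (entDensity m μ x) ∂m ≠ ∞ then
    ((∫⁻ x, ENNReal.ofReal (entDensity m μ x) ∂m : ℝ≥0∞) : EReal) -
      ((∫⁻ x, ENNReal.ofReal (-entDensity m μ x) ∂m : ℝ≥0∞) : EReal)
  else ⊤

/-- The strong `CD(K,∞)` condition: the entropy is `K`-convex along every `W₂`-geodesic with
endpoints in `𝒫₂ᵃᶜ`. If one of the endpoints has entropy `∞`, then the right hand side of the
convexity inequality is read as `∞` (for `0 < t < 1`) and nothing is required. -/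
def StrongCDInfty (m : Measure X) (K : ℝ) : Prop :=
  ∀ μ : I → Measure X, IsW2Geodesic μ → MemP2ac m (μ 0) → MemP2ac m (μ 1) →
    Ent m (μ 0) ≠ ⊤ → Ent m (μ 1) ≠ ⊤ →
      ∀ t : I, Ent m (μ t) ≤
        ((1 - t : ℝ) : EReal) * Ent m (μ 0) + ((t : ℝ) : EReal) * Ent m (μ 1) -
          ((K / 2 * t * (1 - t) * (W2 (μ 0) (μ 1)).toReal ^ 2 : ℝ) : EReal)

end CurvatureDimension

/-! ### The quotient by an isometric action of a compact group -/

/-- For every point `x` the map `g ↦ g • x` is continuous. -/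
class ContinuousOrbitMaps (G M : Type*) [TopologicalSpace G] [TopologicalSpace M] [SMul G M] :
    Prop where
  continuous_orbitMap : ∀ x : M, Continuous fun g : G => g • x

/-- The orbit space `M* = M / G`. -/
def OrbitSpace (G M : Type*) [Group G] [MulAction G M] : Type _ :=
  MulAction.orbitRel.Quotient G M

namespace OrbitSpace

/-- The projection `p : M → M*`. -/
def proj (G : Type*) {M : Type*} [Group G] [MulAction G M] (x : M) : OrbitSpace G M :=
  Quotient.mk (MulAction.orbitRel G M) x

variable {G M : Type*} [Group G] [MulAction G M]

theorem proj_eq_iff {x y : M} : proj G x = proj G y ↔ ∃ g : G, g • x = y :=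
  eq_comm.trans (Quotient.eq (r := MulAction.orbitRel G M) (x := y) (y := x))

theorem proj_surjective : Function.Surjective (proj G : M → OrbitSpace G M) :=
  Quotient.mk_surjective

variable [MetricSpace M]

theorem bddBelow_dist (x y : M) : BddBelow (range fun g : G => dist (g • x) y) :=
  ⟨0, by rintro _ ⟨g, rfl⟩; exact dist_nonneg⟩

theorem iInf_dist_le (g : G) (x y : M) : ⨅ h : G, dist (h • x) y ≤ dist (g • x) y :=
  ciInf_le (bddBelow_dist x y) g

variable [IsIsometricSMul G M]

theorem iInf_dist_smul_le (a b : G) (x y : M) :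
    ⨅ g : G, dist (g • a • x) (b • y) ≤ ⨅ g : G, dist (g • x) y := by
  refine le_ciInf fun g => (iInf_dist_le (b * g * a⁻¹) _ _).trans_eq ?_
  rw [smul_smul, inv_mul_cancel_right, mul_smul, dist_smul]

/-- The quotient distance: `d*(x*, y*) = inf_g d(g x, y)`. -/
instance : Dist (OrbitSpace G M) where
  dist := Quotient.lift₂ (fun x y : M => ⨅ g : G, dist (g • x) y) (by
    rintro x y x' y' ⟨a, rfl⟩ ⟨b, rfl⟩
    refine le_antisymm (iInf_dist_smul_le a b x' y') ?_
    simpa using iInf_dist_smul_le a⁻¹ b⁻¹ (a • x') (b • y'))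

theorem dist_proj (x y : M) : dist (proj G x) (proj G y) = ⨅ g : G, dist (g • x) y := rfl

variable [TopologicalSpace G] [CompactSpace G] [ContinuousOrbitMaps G M]

theorem exists_dist_eq (x y : M) : ∃ g : G, dist (g • x) y = dist (proj G x) (proj G y) := by
  have hc : Continuous fun g : G => dist (g • x) y :=
    (ContinuousOrbitMaps.continuous_orbitMap x).dist continuous_const
  obtain ⟨g, -, hg⟩ := isCompact_univ.exists_isMinOn univ_nonempty hc.continuousOn
  exact ⟨g, le_antisymm (le_ciInf fun h => hg (mem_univ h)) (iInf_dist_le g x y)⟩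

instance : MetricSpace (OrbitSpace G M) where
  dist_self := by
    rintro a
    obtain ⟨x, rfl⟩ := proj_surjective a
    refine le_antisymm ((iInf_dist_le (1 : G) x x).trans_eq ?_)
      (Real.iInf_nonneg fun g => dist_nonneg)
    rw [one_smul, dist_self]
  dist_comm := by
    have key : ∀ x y : M, dist (proj G x) (proj G y) ≤ dist (proj G y) (proj G x) := by
      intro x y
      obtain ⟨g, hg⟩ := exists_dist_eq (G := G) y x
      rw [← hg]
      refine (iInf_dist_le g⁻¹ x y).trans_eq ?_
      rw [← dist_smul g, smul_inv_smul, dist_comm]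
    rintro a b
    obtain ⟨x, rfl⟩ := proj_surjective a
    obtain ⟨y, rfl⟩ := proj_surjective b
    exact le_antisymm (key x y) (key y x)
  dist_triangle := by
    rintro a b c
    obtain ⟨x, rfl⟩ := proj_surjective a
    obtain ⟨y, rfl⟩ := proj_surjective b
    obtain ⟨z, rfl⟩ := proj_surjective c
    obtain ⟨g, hg⟩ := exists_dist_eq (G := G) x y
    obtain ⟨h, hh⟩ := exists_dist_eq (G := G) y z
    rw [← hg, ← hh]
    refine (iInf_dist_le (h * g) x z).trans ?_
    rw [mul_smul, ← dist_smul h (g • x) y]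
    exact dist_triangle _ _ _
  eq_of_dist_eq_zero := by
    rintro a b hab
    obtain ⟨x, rfl⟩ := proj_surjective a
    obtain ⟨y, rfl⟩ := proj_surjective b
    obtain ⟨g, hg⟩ := exists_dist_eq (G := G) x y
    exact proj_eq_iff.2 ⟨g, dist_eq_zero.1 (hg.trans hab)⟩

/-- The Borel `σ`-algebra of the quotient distance. -/
instance : MeasurableSpace (OrbitSpace G M) := borel _

instance : BorelSpace (OrbitSpace G M) := ⟨rfl⟩

/-- The quotient measure `m* = p_♯ m`. -/
def measure (G : Type*) {M : Type*} [Group G] [MulAction G M] [MetricSpace M]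
    [IsIsometricSMul G M] [TopologicalSpace G] [CompactSpace G] [ContinuousOrbitMaps G M]
    [MeasurableSpace M] (m : Measure M) : Measure (OrbitSpace G M) :=
  m.map (proj G)

end OrbitSpace

end QuotCD

end

noncomputable section

namespace QuotCD

/-! ### A measurable selection theorem -/

section Selection

open Filter Topology

variable {X Y : Type*}

/-! A probability measure on `M*` lifts to `M` by choosing a representative in each orbit measurably
and spreading the mass along the orbit with Haar probability (`measureLift`). Right invariance makes
the lift independent of the choice, and the lifts are exactly the `G`-invariant measures. Hence `ρ
m*` lifts to `(ρ ∘ p) m`, and absolute continuity, Rényi functional and entropy are the same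
upstairs and downstairs.

The lift is also isometric for `W₂` (`W2_measureLift`). Since `p` is 1-Lipschitz, projecting a
coupling cannot raise its cost; conversely, a coupling on `M*` lifts at equal cost by choosing
nearest pairs of representatives and averaging under the diagonal action. So `W₂`-geodesics lift to
`W₂`-geodesics. Lifting geodesics of `M*` horizontally and averaging turns an induced coupling into
one upstairs that is concentrated on pairs with `d = d*` (`exists_isInducedCoupling_lift`), so the
distortion terms agree as well. The inequality on `M`, applied to the lifts, is then the inequality
on `M*`.

The measurable choices rest on properness. Compactness of `G` makes `p` and the projection of
horizontal geodesics proper, hence closed, and the Kuratowski–Ryll-Nardzewski theorem applies.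
Properness also replaces local compactness of `M` when horizontal lifts are built as ultralimits of
discrete chains. -/

theorem exists_measurable_refinement [MetricSpace X] [TopologicalSpace.SeparableSpace X]
    [Nonempty X] [MeasurableSpace Y] {q : X → Y}
    (hq : ∀ U : Set X, IsOpen U → MeasurableSet (q '' U))
    {ε ε' : ℝ} (hε' : 0 < ε') {f : Y → ℕ} (hf : Measurable f)
    (h : ∀ y, y ∈ q '' Metric.ball (TopologicalSpace.denseSeq X (f y)) ε) :
    ∃ f' : Y → ℕ, Measurable f' ∧
      (∀ y, y ∈ q '' Metric.ball (TopologicalSpace.denseSeq X (f' y)) ε') ∧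
      ∀ y, dist (TopologicalSpace.denseSeq X (f y)) (TopologicalSpace.denseSeq X (f' y))
        < ε + ε' := by
  classical
  set d := TopologicalSpace.denseSeq X
  -- The fibre must meet the old and the new ball at a common point; this is what keeps successive
  -- centres close.
  have hex : ∀ y, ∃ n, y ∈ q '' (Metric.ball (d (f y)) ε ∩ Metric.ball (d n) ε') := by
    intro y
    obtain ⟨x, hx, rfl⟩ := h y
    obtain ⟨n, hn⟩ := (TopologicalSpace.denseRange_denseSeq X).exists_dist_lt x hε'
    exact ⟨n, x, ⟨hx, hn⟩, rfl⟩
  refine ⟨fun y => Nat.find (hex y), measurable_find hex fun n => ?_, fun y => ?_, fun y => ?_⟩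
  · have : {y | y ∈ q '' (Metric.ball (d (f y)) ε ∩ Metric.ball (d n) ε')} =
        ⋃ k, f ⁻¹' {k} ∩ q '' (Metric.ball (d k) ε ∩ Metric.ball (d n) ε') := by
      ext y
      simp
    rw [this]
    exact MeasurableSet.iUnion fun k => (hf (measurableSet_singleton k)).inter
      (hq _ (Metric.isOpen_ball.inter Metric.isOpen_ball))
  · exact image_mono inter_subset_right (Nat.find_spec (hex y))
  · obtain ⟨x, ⟨hx, hx'⟩, -⟩ := Nat.find_spec (hex y)
    rw [Metric.mem_ball] at hx hx'
    exact (dist_triangle_left _ _ x).trans_lt (add_lt_add hx hx')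

/-- The Kuratowski–Ryll-Nardzewski selection theorem, for the fibres of a surjection. -/
theorem exists_measurable_rightInverse [TopologicalSpace X] [PolishSpace X] [MeasurableSpace X]
    [BorelSpace X] [MeasurableSpace Y] {q : X → Y} (hsurj : Function.Surjective q)
    (hq : ∀ U : Set X, IsOpen U → MeasurableSet (q '' U))
    (hfib : ∀ y, IsClosed (q ⁻¹' {y})) :
    ∃ s : Y → X, Measurable s ∧ ∀ y, q (s y) = y := by
  let _ := TopologicalSpace.upgradeIsCompletelyMetrizable X
  rcases isEmpty_or_nonempty Y with hY | ⟨⟨y₀⟩⟩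
  · exact ⟨fun y => hY.elim y, measurable_of_empty _, fun y => hY.elim y⟩
  obtain ⟨x₀, -⟩ := hsurj y₀
  have : Nonempty X := ⟨x₀⟩
  set d := TopologicalSpace.denseSeq X
  -- Geometric radii make the centres Cauchy for each `y`.
  let r : ℕ → ℝ := fun n => (1 / 2) ^ n
  have hr : ∀ n, 0 < r n := fun n => by positivity
  let S : ℕ → Type _ := fun n =>
    {f : Y → ℕ // Measurable f ∧ ∀ y, y ∈ q '' Metric.ball (d (f y)) (r n)}
  have h0 : ∃ f : Y → ℕ, Measurable f ∧ ∀ y, y ∈ q '' Metric.ball (d (f y)) (r 0) := by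
    classical
    have hex : ∀ y, ∃ n, y ∈ q '' Metric.ball (d n) (r 0) := by
      intro y
      obtain ⟨x, rfl⟩ := hsurj y
      obtain ⟨n, hn⟩ := (TopologicalSpace.denseRange_denseSeq X).exists_dist_lt x (hr 0)
      exact ⟨n, x, hn, rfl⟩
    exact ⟨fun y => Nat.find (hex y), measurable_find hex fun n => hq _ Metric.isOpen_ball,
      fun y => Nat.find_spec (hex y)⟩
  have hstep : ∀ n (f : S n), ∃ f' : S (n + 1),
      ∀ y, dist (d (f.1 y)) (d (f'.1 y)) < r n + r (n + 1) := by
    intro n f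
    obtain ⟨f', h1, h2, h3⟩ := exists_measurable_refinement hq (hr (n + 1)) f.2.1 f.2.2
    exact ⟨⟨f', h1, h2⟩, h3⟩
  choose next hnext using hstep
  let F : ∀ n, S n := fun n => Nat.rec ⟨h0.choose, h0.choose_spec⟩ next n
  have hF : ∀ n y, dist (d ((F n).1 y)) (d ((F (n + 1)).1 y)) ≤ 2 * (1 / 2) ^ n := by
    intro n y
    refine (hnext n (F n) y).le.trans ?_
    simp only [r, pow_succ]
    have := hr n
    simp only [r] at this
    linarith
  have hcau : ∀ y, CauchySeq fun n => d ((F n).1 y) := fun y =>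
    cauchySeq_of_le_geometric _ _ (by norm_num) fun n => hF n y
  choose s hs using fun y => cauchySeq_tendsto_of_complete (hcau y)
  refine ⟨s, measurable_of_tendsto_metrizable (f := fun n y => d ((F n).1 y))
    (fun n => measurable_from_nat.comp (F n).2.1) (tendsto_pi_nhds.2 hs), fun y => ?_⟩
  -- Points of the fibre shadow the centres, so they share the limit `s y`, which therefore lies in
  -- the closed fibre.
  choose x hx hxy using fun n => (F n).2.2 y
  suffices h : s y ∈ q ⁻¹' {y} from h
  refine (hfib y).mem_of_tendsto (f := x) (b := atTop) ?_ (Eventually.of_forall hxy)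
  refine tendsto_of_tendsto_of_dist (hs y) ?_
  refine squeeze_zero (fun _ => dist_nonneg) (fun n => ?_)
    (tendsto_pow_atTop_nhds_zero_of_lt_one (r := (1 / 2 : ℝ)) (by norm_num) (by norm_num))
  rw [dist_comm]
  exact (Metric.mem_ball.1 (hx n)).le

/-- In a metrizable space open sets are countable unions of closed sets, so a closed map sends them
to Borel sets. -/
theorem exists_measurable_rightInverse_of_isClosedMap [TopologicalSpace X] [PolishSpace X]
    [MeasurableSpace X] [BorelSpace X] [TopologicalSpace Y] [T1Space Y] [MeasurableSpace Y]
    [OpensMeasurableSpace Y] {q : X → Y} (hsurj : Function.Surjective q) (hc : Continuous q)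
    (hcl : IsClosedMap q) : ∃ s : Y → X, Measurable s ∧ ∀ y, q (s y) = y := by
  refine exists_measurable_rightInverse hsurj (fun U hU => ?_) fun y =>
    isClosed_singleton.preimage hc
  let _ := TopologicalSpace.upgradeIsCompletelyMetrizable X
  obtain ⟨F, hF, -, rfl, -⟩ := hU.exists_iUnion_isClosed
  rw [image_iUnion]
  exact MeasurableSet.iUnion fun n => (hcl _ (hF n)).measurableSet

end Selection

/-! ### Averaging over a compact group -/

section Averaging

/-- Inversion turns left Haar measure into a right invariant one; the mass is one because the
normalising compact set is the whole group. -/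
theorem exists_isMulRightInvariant_isProbabilityMeasure (G : Type*) [Group G]
    [TopologicalSpace G] [IsTopologicalGroup G] [CompactSpace G] [MeasurableSpace G]
    [BorelSpace G] : ∃ ν : Measure G, ν.IsMulRightInvariant ∧ IsProbabilityMeasure ν := by
  let lam : Measure G := Measure.haarMeasure ⊤
  have hlam : IsProbabilityMeasure lam := ⟨Measure.haarMeasure_self (K₀ := ⊤)⟩
  exact ⟨lam.inv, inferInstance, Measure.isProbabilityMeasure_map measurable_inv.aemeasurable⟩

/-- The image of `ν ⊗ μ` under `(g, z) ↦ g • s z`: the average over `g` of the translates of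
`s_♯ μ`. -/
def haarLift {G Y Z : Type*} [SMul G Y] [MeasurableSpace G] [MeasurableSpace Y]
    [MeasurableSpace Z] (ν : Measure G) (s : Z → Y) (μ : Measure Z) : Measure Y :=
  (ν.prod μ).map fun z => z.1 • s z.2

variable {G Y Z : Type*} [Group G] [TopologicalSpace G] [MeasurableSpace G] [BorelSpace G]
  [TopologicalSpace Y] [TopologicalSpace.MetrizableSpace Y] [SecondCountableTopology Y]
  [MeasurableSpace Y] [BorelSpace Y] [MulAction G Y] [ContinuousSMul G Y]
  [MeasurableSpace Z] {ν : Measure G}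
  {s : Z → Y} {μ : Measure Z}

/-- `G` need not be second countable, so joint continuity does not give measurability for the
product `σ`-algebra. Continuity in the separable metrizable variable `y` and measurability in `g`
do. -/
theorem measurable_smul_comp (hs : Measurable s) :
    Measurable fun z : G × Z => z.1 • s z.2 := by
  have h : Measurable (Function.uncurry fun (y : Y) (g : G) => g • y) :=
    measurable_uncurry_of_continuous_of_measurable (fun g => continuous_const_smul g)
      fun y => (continuous_id.smul continuous_const).measurable
  exact h.comp ((hs.comp measurable_snd).prodMk measurable_fst)

theorem map_haarLift_equivariant {W : Type*} [MeasurableSpace W] [SMul G W]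
    {f : Y → W} (hs : Measurable s)
    (hf : Measurable f) (H : ∀ (g : G) y, f (g • y) = g • f y) :
    (haarLift ν s μ).map f = haarLift ν (f ∘ s) μ := by
  rw [haarLift, Measure.map_map hf (measurable_smul_comp hs)]
  exact congrArg (fun F => (ν.prod μ).map F) (funext fun z => H z.1 (s z.2))

variable [IsProbabilityMeasure ν]

theorem isProbabilityMeasure_haarLift [IsProbabilityMeasure μ] (hs : Measurable s) :
    IsProbabilityMeasure (haarLift ν s μ) :=
  Measure.isProbabilityMeasure_map (measurable_smul_comp hs).aemeasurable

variable [SFinite μ]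

theorem lintegral_haarLift (hs : Measurable s) {f : Y → ℝ≥0∞} (hf : Measurable f) :
    ∫⁻ y, f y ∂haarLift ν s μ = ∫⁻ z, ∫⁻ g, f (g • s z) ∂ν ∂μ := by
  rw [haarLift, lintegral_map hf (measurable_smul_comp hs), lintegral_prod_symm]
  exact (hf.comp (measurable_smul_comp hs)).aemeasurable

theorem haarLift_map {W : Type*} [MeasurableSpace W] {f : Z → W} {s : W → Y}
    (hs : Measurable s) (hf : Measurable f) :
    haarLift ν s (μ.map f) = haarLift ν (s ∘ f) μ := by
  refine Measure.ext_of_lintegral _ fun φ hφ => ?_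
  rw [lintegral_haarLift hs hφ, lintegral_haarLift (hs.comp hf) hφ, lintegral_map _ hf]
  · rfl
  · exact (hφ.comp (measurable_smul_comp hs)).lintegral_prod_left'

theorem map_haarLift {W : Type*} [MeasurableSpace W] {f : Y → W} {h : Z → W}
    (hs : Measurable s) (hf : Measurable f) (hh : Measurable h)
    (H : ∀ (g : G) z, f (g • s z) = h z) : (haarLift ν s μ).map f = μ.map h := by
  rw [haarLift, Measure.map_map hf (measurable_smul_comp hs)]
  have : (f ∘ fun z : G × Z => z.1 • s z.2) = h ∘ Prod.snd := funext fun z => H z.1 z.2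
  rw [this, ← Measure.map_map hh measurable_snd]
  congr 1
  exact measurePreserving_snd.map_eq

/-- Changing the representative by `h` substitutes `g * h` for `g` in the inner integral. This is
done for each `z` separately, so `h` need not depend measurably on `z`. -/
theorem haarLift_congr_orbit [ContinuousMul G] [ν.IsMulRightInvariant] {s' : Z → Y}
    (hs : Measurable s) (hs' : Measurable s') (H : ∀ z, ∃ h : G, h • s z = s' z) :
    haarLift ν s μ = haarLift ν s' μ := by
  refine Measure.ext_of_lintegral _ fun φ hφ => ?_
  rw [lintegral_haarLift hs hφ, lintegral_haarLift hs' hφ]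
  refine lintegral_congr fun z => ?_
  obtain ⟨h, hz⟩ := H z
  rw [← hz, ← lintegral_mul_right_eq_self (fun g => φ (g • s z)) h]
  simp_rw [mul_smul]

theorem haarLift_id_eq_self {μ : Measure Y} [SFinite μ]
    (H : ∀ g : G, μ.map (fun y => g • y) = μ) : haarLift ν id μ = μ := by
  refine Measure.ext_of_lintegral _ fun φ hφ => ?_
  rw [haarLift, lintegral_map hφ (measurable_smul_comp measurable_id), lintegral_prod
    (fun z : G × Y => φ (z.1 • id z.2))
    (hφ.comp (measurable_smul_comp measurable_id)).aemeasurable]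
  have : ∀ g : G, ∫⁻ y, φ (g • id y) ∂μ = ∫⁻ y, φ y ∂μ := fun g => by
    conv_rhs => rw [← H g, lintegral_map hφ (continuous_const_smul g).measurable]
    rfl
  simp_rw [this]
  simp

end Averaging

open Filter Topology

/-! ### The space of geodesics -/

namespace Geo

variable {X : Type*} [MetricSpace X]

theorem dist_eval (γ : Geo X) (s t : I) :
    dist (γ.eval s) (γ.eval t) = |(s : ℝ) - t| * dist (γ.eval 0) (γ.eval 1) :=
  γ.2 s t

theorem isClosed_setOf : IsClosed {γ : C(I, X) |
    ∀ s t : I, dist (γ s) (γ t) = |(s : ℝ) - t| * dist (γ 0) (γ 1)} := by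
  have h : ∀ t : I, Continuous fun γ : C(I, X) => γ t := fun t => continuous_eval_const t
  simp only [ofPred_forall]
  exact isClosed_iInter fun s => isClosed_iInter fun t =>
    isClosed_eq ((h s).dist (h t)) (continuous_const.mul ((h 0).dist (h 1)))

theorem polishSpace [CompleteSpace X] [SecondCountableTopology X] : PolishSpace (Geo X) := by
  have : PolishSpace C(I, X) := {}
  exact (isClosed_setOf (X := X)).polishSpace

theorem continuous_val : Continuous fun γ : Geo X => (γ.1 : C(I, X)) :=
  continuous_subtype_val

theorem continuous_eval (t : I) : Continuous (Geo.eval t : Geo X → X) :=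
  (continuous_eval_const (F := C(I, X)) t).comp continuous_val

/-- Pointwise convergence of geodesics is uniform. -/
theorem tendsto_of_forall_eval {ι : Type*} {l : Filter ι} {γ : ι → Geo X} {x : Geo X}
    (h : ∀ t, Tendsto (fun i => (γ i).eval t) l (𝓝 (x.eval t))) : Tendsto γ l (𝓝 x) := by
  refine tendsto_subtype_rng.2 ((ContinuousMap.tendsto_iff_tendstoUniformly).2
    (Metric.tendstoUniformly_iff.2 fun ε hε => ?_))
  -- `R` is a common Lipschitz constant for the limit and, eventually, for the `γ i`; convergence on
  -- a finite `ε / (4 * R)`-net then suffices.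
  set R := dist (x.eval 0) (x.eval 1) + 1 with hR
  have hRpos : 0 < R := by positivity
  obtain ⟨T, -, hT, hcov⟩ := finite_cover_balls_of_compact (isCompact_univ (X := I))
    (show 0 < ε / (4 * R) by positivity)
  have h1 : ∀ᶠ i in l, dist ((γ i).eval 0) ((γ i).eval 1) < R :=
    ((h 0).dist (h 1)).eventually_lt_const (lt_add_one _)
  have h2 : ∀ᶠ i in l, ∀ t ∈ T, dist ((γ i).eval t) (x.eval t) < ε / 4 :=
    (eventually_all_finite hT).2 fun t _ => Metric.tendsto_nhds.1 (h t) _ (by positivity)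
  filter_upwards [h1, h2] with i hi1 hi2 s
  obtain ⟨t, ht, hst⟩ := mem_iUnion₂.1 (hcov (mem_univ s))
  rw [Metric.mem_ball, Subtype.dist_eq, Real.dist_eq] at hst
  have key : ∀ γ' : Geo X, dist (γ'.eval 0) (γ'.eval 1) ≤ R →
      dist (γ'.eval s) (γ'.eval t) ≤ ε / 4 := fun γ' hγ' => by
    rw [dist_eval]
    calc _ ≤ ε / (4 * R) * R := by gcongr
      _ = ε / 4 := by field_simp
  have e1 := key (γ i) hi1.le
  have e2 := key x (by linarith)
  have e3 := hi2 t ht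
  calc dist (x.eval s) ((γ i).eval s)
      ≤ dist (x.eval s) (x.eval t) + dist (x.eval t) ((γ i).eval t)
        + dist ((γ i).eval t) ((γ i).eval s) := dist_triangle4 _ _ _ _
    _ < ε := by
      rw [dist_comm (x.eval t) ((γ i).eval t), dist_comm ((γ i).eval t) ((γ i).eval s)]
      linarith

/-- The geodesic with a given underlying function. -/
def ofDist (x : I → X) (h : ∀ s t, dist (x s) (x t) = |(s : ℝ) - t| * dist (x 0) (x 1)) :
    Geo X :=
  ⟨⟨x, (LipschitzWith.of_dist_le_mul (K := ⟨dist (x 0) (x 1), dist_nonneg⟩) fun s t => by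
    rw [h s t, Subtype.dist_eq, Real.dist_eq, mul_comm]; rfl).continuous⟩, h⟩

variable {G : Type*} [Group G] [MulAction G X] [IsIsometricSMul G X]

instance : SMul G (Geo X) :=
  ⟨fun g γ => ofDist (fun t => g • γ.eval t) fun s t => by
    simp only [dist_smul]; exact γ.dist_eval s t⟩

theorem eval_smul (g : G) (γ : Geo X) (t : I) : (g • γ).eval t = g • γ.eval t := rfl

theorem ext_eval {γ γ' : Geo X} (h : ∀ t, γ.eval t = γ'.eval t) : γ = γ' :=
  Subtype.ext (ContinuousMap.ext h)

instance : MulAction G (Geo X) where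
  one_smul _ := ext_eval fun _ => one_smul G _
  mul_smul g h _ := ext_eval fun _ => mul_smul g h _

instance [TopologicalSpace G] [ContinuousSMul G X] : ContinuousSMul G (Geo X) where
  continuous_smul := by
    refine Continuous.subtype_mk (ContinuousMap.continuous_of_continuous_uncurry _ ?_) _
    have h : Continuous fun z : (G × Geo X) × I => z.1.2.1 z.2 :=
      (continuous_val.comp (continuous_snd.comp continuous_fst)).eval continuous_snd
    exact (continuous_fst.comp continuous_fst).smul h

end Geo

/-! ### The orbit space -/

namespace OrbitSpace

variable {G M : Type*} [Group G] [MulAction G M]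

theorem proj_smul (g : G) (x : M) : proj G (g • x) = proj G x :=
  (proj_eq_iff.2 ⟨g, rfl⟩).symm

variable [MetricSpace M] [IsIsometricSMul G M]

theorem dist_proj_le (x y : M) : dist (proj G x) (proj G y) ≤ dist x y :=
  (iInf_dist_le (1 : G) x y).trans_eq (by rw [one_smul])

variable [TopologicalSpace G] [CompactSpace G] [ContinuousOrbitMaps G M]

/-- Isometries are equicontinuous, so continuity of the orbit maps already gives joint continuity.
-/
instance : ContinuousSMul G M where
  continuous_smul := by
    refine continuous_iff_continuousAt.2 fun ⟨g, x⟩ => tendsto_iff_dist_tendsto_zero.2 ?_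
    have h : Tendsto (fun z : G × M => dist z.2 x + dist (z.1 • x) (g • x)) (𝓝 (g, x)) (𝓝 0) := by
      have : Continuous fun z : G × M => dist z.2 x + dist (z.1 • x) (g • x) :=
        (continuous_snd.dist continuous_const).add
          (((ContinuousOrbitMaps.continuous_orbitMap x).comp continuous_fst).dist
            continuous_const)
      simpa using this.tendsto (g, x)
    refine squeeze_zero (fun _ => dist_nonneg) (fun z => ?_) h
    rw [← dist_smul z.1 z.2 x]
    exact dist_triangle _ _ _

theorem continuous_proj : Continuous (proj G : M → OrbitSpace G M) :=
  (LipschitzWith.mk_one dist_proj_le).continuous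

theorem exists_proj_eq_dist_eq (x : M) (b : OrbitSpace G M) :
    ∃ y, proj G y = b ∧ dist x y = dist (proj G x) b := by
  obtain ⟨z, rfl⟩ := proj_surjective b
  obtain ⟨g, hg⟩ := exists_dist_eq (G := G) z x
  exact ⟨g • z, proj_smul g z, by rw [dist_comm, hg, dist_comm]⟩

/-- Let `g z • x` be the point of the orbit of `x` nearest to `z`. By compactness `g` converges to
some `a` along the ultrafilter, and `z` follows `g z • x` to `a • x`. -/
theorem isProperMap_proj : IsProperMap (proj G : M → OrbitSpace G M) := by
  refine isProperMap_iff_ultrafilter.2 ⟨continuous_proj, fun 𝒰 b h => ?_⟩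
  obtain ⟨x, rfl⟩ := proj_surjective b
  choose g hg using fun z => exists_dist_eq (G := G) x z
  set a := (𝒰.map g).lim
  have ha : Tendsto g 𝒰 (𝓝 a) := (𝒰.map g).le_nhds_lim
  refine ⟨a • x, proj_smul a x, ?_⟩
  have h1 : Tendsto (fun z => g z • x) 𝒰 (𝓝 (a • x)) :=
    ((ContinuousOrbitMaps.continuous_orbitMap x).tendsto a).comp ha
  have h2 : Tendsto (fun z => dist (g z • x) z) 𝒰 (𝓝 0) := by
    simp_rw [hg]
    have := (tendsto_const_nhds (x := proj G x)).dist h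
    rwa [dist_self] at this
  exact tendsto_of_tendsto_of_dist h1 h2

theorem exists_tendsto_of_tendsto_proj {ι : Type*} {𝒰 : Ultrafilter ι} {f : ι → M}
    {b : OrbitSpace G M} (h : Tendsto (fun i => proj G (f i)) 𝒰 (𝓝 b)) :
    ∃ y, proj G y = b ∧ Tendsto f 𝒰 (𝓝 y) :=
  (isProperMap_iff_ultrafilter.1 isProperMap_proj).2 (𝒰 := 𝒰.map f) h

/-- A sequence of orbits has representatives with minimal consecutive distances. -/
theorem exists_lift_seq (u : ℕ → OrbitSpace G M) : ∃ x : ℕ → M,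
    (∀ n, proj G (x n) = u n) ∧ ∀ n, dist (x n) (x (n + 1)) = dist (u n) (u (n + 1)) := by
  obtain ⟨x₀, h₀⟩ := proj_surjective (u 0)
  choose f hf1 hf2 using fun (n : ℕ) (x : M) => exists_proj_eq_dist_eq x (u (n + 1))
  let x : ℕ → M := fun n => Nat.rec x₀ f n
  have hx : ∀ n, proj G (x n) = u n := by
    rintro (_ | n)
    · exact h₀
    · exact hf1 n _
  exact ⟨x, hx, fun n => (hf2 n (x n)).trans (by rw [hx n])⟩

theorem completeSpace [CompleteSpace M] : CompleteSpace (OrbitSpace G M) := by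
  refine Metric.complete_of_convergent_controlled_sequences (fun n => (1 / 2) ^ n)
    (fun n => by positivity) fun u hu => ?_
  obtain ⟨x, hx, hd⟩ := exists_lift_seq u
  have hc : CauchySeq x := cauchySeq_of_le_geometric (1 / 2) 1 (by norm_num) fun n => by
    rw [hd, one_mul]
    exact (hu n n (n + 1) le_rfl n.le_succ).le
  obtain ⟨y, hy⟩ := cauchySeq_tendsto_of_complete hc
  refine ⟨proj G y, ?_⟩
  have := (continuous_proj (G := G)).continuousAt.tendsto.comp hy
  exact this.congr hx

theorem separableSpace [TopologicalSpace.SeparableSpace M] :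
    TopologicalSpace.SeparableSpace (OrbitSpace G M) :=
  proj_surjective.denseRange.separableSpace continuous_proj

/-- The projection of a geodesic that minimises the distance between the orbits of its
endpoints is a geodesic. -/
theorem dist_proj_eval {γ : Geo M}
    (h : dist (γ.eval 0) (γ.eval 1) = dist (proj G (γ.eval 0)) (proj G (γ.eval 1))) (s t : I) :
    dist (proj G (γ.eval s)) (proj G (γ.eval t)) =
      |(s : ℝ) - t| * dist (proj G (γ.eval 0)) (proj G (γ.eval 1)) := by
  wlog hst : s ≤ t generalizing s t
  · rw [dist_comm, abs_sub_comm]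
    exact this t s (le_of_not_ge hst)
  have h1 : ∀ s t : I, dist (proj G (γ.eval s)) (proj G (γ.eval t)) ≤
      |(s : ℝ) - t| * dist (proj G (γ.eval 0)) (proj G (γ.eval 1)) := fun s t => by
    rw [← h, ← γ.dist_eval]
    exact dist_proj_le _ _
  refine (h1 s t).antisymm ?_
  -- Each of the three pieces is at most its share of the total length, and together they must cover
  -- it; so the middle piece attains its bound.
  have e := dist_triangle4 (proj G (γ.eval 0)) (proj G (γ.eval s)) (proj G (γ.eval t))
    (proj G (γ.eval 1))
  have e0 := h1 0 s
  have e1 := h1 t 1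
  have hst' : (s : ℝ) ≤ t := hst
  rw [abs_sub_comm, abs_of_nonneg (by simpa using s.2.1)] at e0
  rw [abs_sub_comm, abs_of_nonneg (by simpa using t.2.2)] at e1
  rw [abs_sub_comm, abs_of_nonneg (by linarith)]
  simp only [Icc.coe_zero, Icc.coe_one] at e0 e1
  linarith

variable (G M) in
/-- Geodesics of `M` that minimise the distance between the orbits of their endpoints. -/
abbrev HorizontalGeo : Type _ :=
  {γ : Geo M // dist (γ.eval 0) (γ.eval 1) = dist (proj G (γ.eval 0)) (proj G (γ.eval 1))}

theorem isClosed_horizontal : IsClosed {γ : Geo M |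
    dist (γ.eval 0) (γ.eval 1) = dist (proj G (γ.eval 0)) (proj G (γ.eval 1))} :=
  isClosed_eq ((Geo.continuous_eval 0).dist (Geo.continuous_eval 1))
    ((continuous_proj.comp (Geo.continuous_eval 0)).dist
      (continuous_proj.comp (Geo.continuous_eval 1)))

/-- The projection of horizontal geodesics. -/
def geoProj (γ : HorizontalGeo G M) : Geo (OrbitSpace G M) :=
  Geo.ofDist (fun t => proj G (γ.1.eval t)) (dist_proj_eval γ.2)

/-- Properness of `proj` gives a limit at each time. The geodesic and horizontality equations pass
to pointwise limits, and for geodesics pointwise convergence is uniform. -/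
theorem isProperMap_geoProj :
    IsProperMap (geoProj : HorizontalGeo G M → Geo (OrbitSpace G M)) := by
  have hev : ∀ t : I, Continuous fun γ : HorizontalGeo G M => γ.1.eval t := fun t =>
    (Geo.continuous_eval t).comp continuous_subtype_val
  refine isProperMap_iff_ultrafilter.2 ⟨?_, fun 𝒰 β h => ?_⟩
  · exact continuous_iff_continuousAt.2 fun γ => Geo.tendsto_of_forall_eval fun t =>
      (continuous_proj.comp (hev t)).continuousAt
  have hproj : ∀ t : I, Tendsto (fun γ : HorizontalGeo G M => proj G (γ.1.eval t)) 𝒰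
      (𝓝 (β.eval t)) := fun t => ((Geo.continuous_eval t).tendsto β).comp h
  choose x hx hlim using fun t : I => exists_tendsto_of_tendsto_proj (hproj t)
  have hd : ∀ s t : I, dist (x s) (x t) = |(s : ℝ) - t| * dist (x 0) (x 1) := fun s t =>
    tendsto_nhds_unique ((hlim s).dist (hlim t)) <| by
      simp_rw [Geo.dist_eval _ s t]
      exact ((hlim 0).dist (hlim 1)).const_mul _
  have hh : dist (x 0) (x 1) = dist (proj G (x 0)) (proj G (x 1)) :=
    tendsto_nhds_unique ((hlim 0).dist (hlim 1)) <| by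
      rw [hx, hx]
      refine ((hproj 0).dist (hproj 1)).congr fun γ => γ.2.symm
  exact ⟨⟨Geo.ofDist x hd, hh⟩, Geo.ext_eval hx,
    tendsto_subtype_rng.2 (Geo.tendsto_of_forall_eval hlim)⟩

/-- Every geodesic of the orbit space has a horizontal lift. -/
theorem geoProj_surjective :
    Function.Surjective (geoProj : HorizontalGeo G M → Geo (OrbitSpace G M)) := by
  intro β
  set ℓ := dist (β.eval 0) (β.eval 1)
  have hℓ : 0 ≤ ℓ := dist_nonneg
  let τ : ℝ → I := projIcc 0 1 (zero_le_one' ℝ)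
  have hβ : ∀ a b : ℝ, dist (β.eval (τ a)) (β.eval (τ b)) ≤ |a - b| * ℓ := fun a b => by
    rw [β.dist_eval]
    exact mul_le_mul_of_nonneg_right (abs_projIcc_sub_projIcc (zero_le_one' ℝ)) hℓ
  have hβ' : ∀ t : I, τ t = t := fun t => projIcc_val (zero_le_one' ℝ) t
  -- Sample `β` with mesh `1 / (n + 1)` and lift the samples to a chain with the same step lengths;
  -- `τ` clamps indices beyond the end.
  choose c hc hcd using fun n : ℕ =>
    exists_lift_seq fun k : ℕ => β.eval (τ ((k : ℝ) / (n + 1)))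
  have hchain : ∀ n j k : ℕ, dist (c n j) (c n k) ≤ |(j : ℝ) - k| / (n + 1) * ℓ := by
    intro n j k
    wlog hjk : j ≤ k generalizing j k
    · rw [dist_comm, abs_sub_comm]
      exact this k j (le_of_not_ge hjk)
    refine (dist_le_Ico_sum_of_dist_le hjk (d := fun _ => 1 / (n + 1) * ℓ) fun {i} _ _ => ?_).trans ?_
    · rw [hcd]
      refine (hβ _ _).trans_eq ?_
      congr 1
      rw [← sub_div, abs_div, abs_of_pos (show (0 : ℝ) < n + 1 by positivity)]
      simp
    · have : (j : ℝ) ≤ k := by exact_mod_cast hjk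
      rw [Finset.sum_const, Nat.card_Ico, nsmul_eq_mul, Nat.cast_sub hjk, abs_sub_comm,
        abs_of_nonneg (by linarith)]
      exact le_of_eq (by ring)
  let k : ℕ → I → ℕ := fun n t => ⌊(t : ℝ) * (n + 1)⌋₊
  have hk1 : ∀ n (t : I), (k n t : ℝ) ≤ (t : ℝ) * (n + 1) := fun n t =>
    Nat.floor_le (mul_nonneg t.2.1 (by positivity))
  have hk2 : ∀ n (t : I), (t : ℝ) * (n + 1) < (k n t : ℝ) + 1 := fun n t => Nat.lt_floor_add_one _
  -- One nonprincipal ultrafilter yields limits at all times simultaneously, so no diagonal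
  -- extraction is needed.
  have hinv : Tendsto (fun n : ℕ => 1 / ((n : ℝ) + 1)) (hyperfilter ℕ) (𝓝 0) :=
    tendsto_one_div_add_atTop_nhds_zero_nat.mono_left Nat.hyperfilter_le_atTop
  have hproj : ∀ t : I, Tendsto (fun n => proj G (c n (k n t))) (hyperfilter ℕ)
      (𝓝 (β.eval t)) := by
    intro t
    simp_rw [hc]
    refine tendsto_iff_dist_tendsto_zero.2 (squeeze_zero (fun _ => dist_nonneg) (fun n => ?_)
      (by simpa using hinv.mul_const ℓ))
    rw [← hβ' t]
    refine (hβ _ _).trans ?_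
    rw [hβ']
    have hn : (0 : ℝ) < n + 1 := by positivity
    gcongr
    have h : |(k n t : ℝ) / (n + 1) - t| * (n + 1) = |(k n t : ℝ) - t * (n + 1)| := by
      rw [← abs_of_pos hn, ← abs_mul, abs_of_pos hn, sub_mul, div_mul_cancel₀ _ hn.ne']
    rw [← one_div, le_div_iff₀ hn, h, abs_sub_le_iff]
    constructor <;> linarith [hk1 n t, hk2 n t]
  choose x hx hlim using fun t : I => exists_tendsto_of_tendsto_proj (hproj t)
  have hle : ∀ s t : I, dist (x s) (x t) ≤ |(s : ℝ) - t| * ℓ := by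
    intro s t
    have h1 : Tendsto (fun n : ℕ => (|(s : ℝ) - t| + 1 / ((n : ℝ) + 1)) * ℓ) (hyperfilter ℕ)
        (𝓝 (|(s : ℝ) - t| * ℓ)) := by
      simpa using (hinv.const_add |(s : ℝ) - t|).mul_const ℓ
    refine le_of_tendsto_of_tendsto' ((hlim s).dist (hlim t)) h1 fun n => ?_
    refine (hchain n _ _).trans ?_
    have hn : (0 : ℝ) < n + 1 := by positivity
    gcongr
    rw [div_le_iff₀ hn, add_mul, div_mul_cancel₀ _ hn.ne']
    have : |(s : ℝ) - t| * (n + 1) = |(s : ℝ) * (n + 1) - t * (n + 1)| := by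
      rw [← sub_mul, abs_mul, abs_of_pos hn]
    rw [this]
    rcases abs_cases ((s : ℝ) * (n + 1) - t * (n + 1)) with h | h <;>
      rw [h.1, abs_sub_le_iff] <;> constructor <;>
      linarith [hk1 n t, hk2 n t, hk1 n s, hk2 n s]
  -- The chain bounds distances from above; projecting, which cannot increase them, bounds them from
  -- below.
  have heq : ∀ s t : I, dist (x s) (x t) = |(s : ℝ) - t| * ℓ := fun s t => by
    refine (hle s t).antisymm ?_
    rw [← β.dist_eval, ← hx, ← hx]
    exact dist_proj_le _ _
  have h01 : dist (x 0) (x 1) = ℓ := by simpa using heq 0 1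
  exact ⟨⟨Geo.ofDist x fun s t => by rw [heq, h01], by
    change dist (x 0) (x 1) = dist (proj G (x 0)) (proj G (x 1))
    rw [h01, hx, hx]⟩, Geo.ext_eval hx⟩

theorem exists_geo (hM : ∀ x y : M, ∃ γ : Geo M, γ.eval 0 = x ∧ γ.eval 1 = y)
    (a b : OrbitSpace G M) : ∃ γ : Geo (OrbitSpace G M), γ.eval 0 = a ∧ γ.eval 1 = b := by
  obtain ⟨x, rfl⟩ := proj_surjective a
  obtain ⟨y, rfl, hy⟩ := exists_proj_eq_dist_eq x b
  obtain ⟨γ, rfl, rfl⟩ := hM x y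
  exact ⟨geoProj ⟨γ, hy⟩, rfl, rfl⟩

/-! ### Measurable lifts -/

variable [SecondCountableTopology M]

instance : SecondCountableTopology (OrbitSpace G M) :=
  have := separableSpace (G := G) (M := M)
  UniformSpace.secondCountable_of_separable _

variable [CompleteSpace M]

theorem exists_measurable_geo_lift : ∃ S : Geo (OrbitSpace G M) → Geo M, Measurable S ∧
    ∀ β, (∀ t, proj G ((S β).eval t) = β.eval t) ∧
      dist ((S β).eval 0) ((S β).eval 1) = dist (β.eval 0) (β.eval 1) := by
  have : PolishSpace (Geo M) := Geo.polishSpace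
  have : CompleteSpace (OrbitSpace G M) := completeSpace
  have : PolishSpace (Geo (OrbitSpace G M)) := Geo.polishSpace
  have : PolishSpace (HorizontalGeo G M) := isClosed_horizontal.polishSpace
  have hp := isProperMap_geoProj (G := G) (M := M)
  obtain ⟨s, hs, hps⟩ := exists_measurable_rightInverse_of_isClosedMap
    (geoProj_surjective (G := G) (M := M)) hp.continuous hp.isClosedMap
  have hev : ∀ β t, proj G ((s β).1.eval t) = β.eval t := fun β t =>
    congrArg (Geo.eval t) (hps β)
  refine ⟨fun β => (s β).1, measurable_subtype_coe.comp hs, fun β => ⟨hev β, ?_⟩⟩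
  rw [(s β).2, hev, hev]

variable [MeasurableSpace M] [BorelSpace M]

theorem exists_measurable_pair_lift :
    ∃ s : OrbitSpace G M × OrbitSpace G M → M × M, Measurable s ∧
      ∀ z, proj G (s z).1 = z.1 ∧ proj G (s z).2 = z.2 ∧
        dist (s z).1 (s z).2 = dist z.1 z.2 := by
  let C : Set (M × M) := {z | dist z.1 z.2 = dist (proj G z.1) (proj G z.2)}
  have hC : IsClosed C := isClosed_eq (continuous_fst.dist continuous_snd)
    ((continuous_proj.comp continuous_fst).dist (continuous_proj.comp continuous_snd))
  have : PolishSpace C := hC.polishSpace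
  let q : C → OrbitSpace G M × OrbitSpace G M := fun z => (proj G z.1.1, proj G z.1.2)
  have hq : IsProperMap q :=
    (isProperMap_proj.prodMap isProperMap_proj).comp hC.isClosedEmbedding_subtypeVal.isProperMap
  obtain ⟨s, hs, hqs⟩ := exists_measurable_rightInverse_of_isClosedMap (q := q) (by
    rintro ⟨a, b⟩
    obtain ⟨x, rfl⟩ := proj_surjective a
    obtain ⟨y, rfl, hy⟩ := exists_proj_eq_dist_eq x b
    exact ⟨⟨(x, y), hy⟩, rfl⟩) hq.continuous hq.isClosedMap
  have h1 : ∀ z, proj G (s z).1.1 = z.1 := fun z => congrArg Prod.fst (hqs z)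
  have h2 : ∀ z, proj G (s z).1.2 = z.2 := fun z => congrArg Prod.snd (hqs z)
  refine ⟨fun z => (s z).1, measurable_subtype_coe.comp hs, fun z => ⟨h1 z, h2 z, ?_⟩⟩
  rw [(s z).2, h1, h2]

theorem exists_measurable_lift :
    ∃ s : OrbitSpace G M → M, Measurable s ∧ ∀ z, proj G (s z) = z :=
  exists_measurable_rightInverse_of_isClosedMap proj_surjective isProperMap_proj.continuous
    isProperMap_proj.isClosedMap

end OrbitSpace

namespace OrbitSpace

/-! ### Lifts of measures on the orbit space -/

variable {G M : Type*} [Group G] [MulAction G M] [MetricSpace M] [IsIsometricSMul G M]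
  [TopologicalSpace G] [CompactSpace G] [ContinuousOrbitMaps G M]
  [MeasurableSpace M] [BorelSpace M]

theorem measurable_proj : Measurable (proj G : M → OrbitSpace G M) :=
  continuous_proj.measurable

theorem map_proj_haarLift [SecondCountableTopology M] [MeasurableSpace G] [BorelSpace G]
    {ν : Measure G} [IsProbabilityMeasure ν] {Z : Type*} [MeasurableSpace Z] {ζ : Measure Z}
    [SFinite ζ] {f : Z → M} (hf : Measurable f) :
    (haarLift ν f ζ).map (proj G) = ζ.map fun z => proj G (f z) :=
  map_haarLift hf measurable_proj (measurable_proj.comp hf) fun g _ => proj_smul g _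

variable [CompleteSpace M] [SecondCountableTopology M]

variable (G M) in
/-- A Borel section of the projection. -/
def borelSection : OrbitSpace G M → M := exists_measurable_lift.choose

theorem measurable_borelSection : Measurable (borelSection G M) :=
  exists_measurable_lift.choose_spec.1

theorem proj_borelSection (z : OrbitSpace G M) : proj G (borelSection G M z) = z :=
  exists_measurable_lift.choose_spec.2 z

variable [MeasurableSpace G] [BorelSpace G]

/-- The lift of a measure on the orbit space, uniformly distributed along the orbits. -/
def measureLift (ν : Measure G) (μ : Measure (OrbitSpace G M)) : Measure M :=
  haarLift ν (borelSection G M) μ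

variable {ν : Measure G} [IsProbabilityMeasure ν] {μ μ' : Measure (OrbitSpace G M)}
  {Z : Type*} [MeasurableSpace Z]

theorem map_proj_measureLift [SFinite μ] : (measureLift ν μ).map (proj G) = μ := by
  rw [measureLift, map_proj_haarLift measurable_borelSection]
  simp_rw [proj_borelSection]
  exact Measure.map_id

theorem isProbabilityMeasure_measureLift [IsProbabilityMeasure μ] :
    IsProbabilityMeasure (measureLift ν μ) :=
  isProbabilityMeasure_haarLift measurable_borelSection

/-- An average over `G` is determined by its projection. This identifies the marginals of every
lifted plan. -/
theorem haarLift_eq_measureLift [ContinuousMul G] [ν.IsMulRightInvariant] {ζ : Measure Z}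
    [SFinite ζ] {f : Z → M} (hf : Measurable f) :
    haarLift ν f ζ = measureLift ν (ζ.map fun z => proj G (f z)) := by
  have hpf : Measurable fun z => proj G (f z) := measurable_proj.comp hf
  rw [measureLift, haarLift_map measurable_borelSection hpf]
  exact haarLift_congr_orbit hf (measurable_borelSection.comp hpf) fun z =>
    proj_eq_iff.1 (proj_borelSection (proj G (f z))).symm

variable [ContinuousMul G] [ν.IsMulRightInvariant]

theorem measureLift_map_proj {κ : Measure M} [SFinite κ]
    (hκ : ∀ g : G, κ.map (fun x => g • x) = κ) : measureLift ν (κ.map (proj G)) = κ := by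
  conv_rhs => rw [← haarLift_id_eq_self (ν := ν) hκ]
  exact (haarLift_eq_measureLift measurable_id).symm

variable {m : Measure M} [SigmaFinite m]

/-- Images of `σ`-finite measures need not be `σ`-finite. Here a positive integrable function on
`M`, averaged along orbits, descends to a positive `Φ` with finite integral, and `m*` has the finite
density `Φ⁻¹` against the finite measure `Φ m*`. -/
theorem sigmaFinite_measure (ν : Measure G) [IsProbabilityMeasure ν]
    [ν.IsMulRightInvariant] (hm : ∀ g : G, m.map (fun x => g • x) = m) :
    SigmaFinite (OrbitSpace.measure G m) := by
  obtain ⟨φ, hφ, hφm, hφi⟩ := exists_pos_lintegral_lt_of_sigmaFinite m one_ne_zero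
  have hφm' : Measurable fun x => (φ x : ℝ≥0∞) := hφm.coe_nnreal_ennreal
  let Φ : OrbitSpace G M → ℝ≥0∞ := fun z => ∫⁻ g, φ (g • borelSection G M z) ∂ν
  have hΦm : Measurable Φ :=
    (hφm'.comp (measurable_smul_comp (G := G) measurable_borelSection)).lintegral_prod_left'
  have hΦi : ∫⁻ z, Φ z ∂(OrbitSpace.measure G m) < 1 := by
    have h := measureLift_map_proj (ν := ν) hm
    rwa [← h, measureLift, lintegral_haarLift measurable_borelSection hφm'] at hφi
  have hΦ0 : ∀ z, Φ z ≠ 0 := fun z h => by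
    have hmg : Measurable fun g : G => (φ (g • borelSection G M z) : ℝ≥0∞) :=
      hφm'.comp ((ContinuousOrbitMaps.continuous_orbitMap _).measurable)
    have := (lintegral_eq_zero_iff hmg).1 h
    obtain ⟨g, hg⟩ := this.exists
    exact (hφ _).ne' (ENNReal.coe_eq_zero.1 hg)
  have hfin : IsFiniteMeasure ((OrbitSpace.measure G m).withDensity Φ) :=
    isFiniteMeasure_withDensity hΦi.ne_top
  rw [← withDensity_inv_same hΦm (Filter.Eventually.of_forall hΦ0)
    ((ae_lt_top hΦm hΦi.ne_top).mono fun _ h => h.ne)]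
  exact SigmaFinite.withDensity_of_ne_top
    (Filter.Eventually.of_forall fun z => ENNReal.inv_ne_top.2 (hΦ0 z))

/-- The measure `(ρ ∘ p) m` is `G`-invariant and projects to `ρ m*`, so it is the lift of its
projection. -/
theorem measureLift_withDensity
    (hm : ∀ g : G, m.map (fun x => g • x) = m) {ρ : OrbitSpace G M → ℝ≥0∞} (hρ : Measurable ρ) :
    measureLift ν ((OrbitSpace.measure G m).withDensity ρ) =
      m.withDensity fun x => ρ (proj G x) := by
  have hρp : Measurable fun x => ρ (proj G x) := hρ.comp measurable_proj
  have h1 : (m.withDensity fun x => ρ (proj G x)).map (proj G) =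
      (OrbitSpace.measure G m).withDensity ρ := by
    refine Measure.ext_of_lintegral _ fun φ hφ => ?_
    rw [lintegral_map hφ measurable_proj, lintegral_withDensity_eq_lintegral_mul _ hρp
      (g := fun x => φ (proj G x)) (hφ.comp measurable_proj),
      lintegral_withDensity_eq_lintegral_mul _ hρ hφ,
      OrbitSpace.measure, lintegral_map (hρ.mul hφ) measurable_proj]
    rfl
  rw [← h1]
  refine measureLift_map_proj fun g => Measure.ext_of_lintegral _ fun φ hφ => ?_
  have hg : Measurable fun x : M => g • x := (continuous_const_smul g).measurable
  rw [lintegral_map hφ hg, lintegral_withDensity_eq_lintegral_mul _ hρp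
    (g := fun x => φ (g • x)) (hφ.comp hg),
    lintegral_withDensity_eq_lintegral_mul _ hρp hφ]
  conv_rhs => rw [← hm g, lintegral_map (hρp.mul hφ) hg]
  simp only [Pi.mul_apply, proj_smul]

variable [SigmaFinite μ]

theorem measureLift_eq_withDensity
    (hm : ∀ g : G, m.map (fun x => g • x) = m) (h : μ ≪ OrbitSpace.measure G m) :
    measureLift ν μ =
      m.withDensity fun x => μ.rnDeriv (OrbitSpace.measure G m) (proj G x) := by
  have := sigmaFinite_measure ν hm
  rw [← measureLift_withDensity (ν := ν) hm (Measure.measurable_rnDeriv _ _),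
    Measure.withDensity_rnDeriv_eq _ _ h]

theorem measureLift_absolutelyContinuous_iff
    (hm : ∀ g : G, m.map (fun x => g • x) = m) :
    measureLift ν μ ≪ m ↔ μ ≪ OrbitSpace.measure G m := by
  refine ⟨fun h => ?_, fun h => ?_⟩
  · rw [← map_proj_measureLift (ν := ν) (μ := μ)]
    exact h.map measurable_proj
  · rw [measureLift_eq_withDensity hm h]
    exact withDensity_absolutelyContinuous _ _

theorem rnDeriv_measureLift
    (hm : ∀ g : G, m.map (fun x => g • x) = m) (h : μ ≪ OrbitSpace.measure G m) :
    (measureLift ν μ).rnDeriv m =ᵐ[m]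
      fun x => μ.rnDeriv (OrbitSpace.measure G m) (proj G x) := by
  rw [measureLift_eq_withDensity hm h]
  exact Measure.rnDeriv_withDensity _ ((Measure.measurable_rnDeriv _ _).comp measurable_proj)

theorem renyi_measureLift
    (hm : ∀ g : G, m.map (fun x => g • x) = m) (h : μ ≪ OrbitSpace.measure G m) (N : ℝ) :
    renyi m (measureLift ν μ) N = renyi (OrbitSpace.measure G m) μ N := by
  have hρ := Measure.measurable_rnDeriv μ (OrbitSpace.measure G m)
  -- Absorbing the domain into the integrand leaves a Borel function of the density alone, to which
  -- a.e. equality and change of variables apply.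
  have key : ∀ {X : Type _} [MeasurableSpace X] (f : X → ℝ≥0∞) (κ : Measure X), Measurable f →
      ∫⁻ x in {x | f x ≠ 0}, f x ^ (1 - 1 / N) ∂κ =
        ∫⁻ x, ({0}ᶜ : Set ℝ≥0∞).indicator (fun r => r ^ (1 - 1 / N)) (f x) ∂κ :=
    fun f κ hf => by
      have h0 : MeasurableSet {x | f x ≠ 0} := hf (measurableSet_singleton 0).compl
      rw [← lintegral_indicator h0]
      rfl
  have hmeas : Measurable (({0}ᶜ : Set ℝ≥0∞).indicator fun r => r ^ (1 - 1 / N)) :=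
    Measurable.indicator (by fun_prop) (measurableSet_singleton 0).compl
  rw [renyi, renyi, key _ _ (Measure.measurable_rnDeriv _ _), key _ _ hρ]
  conv_rhs => rw [OrbitSpace.measure]
  rw [lintegral_map _ measurable_proj]
  · exact lintegral_congr_ae ((rnDeriv_measureLift (ν := ν) hm h).mono fun x hx => by
      simp only [hx]; rfl)
  · exact hmeas.comp (Measure.measurable_rnDeriv _ _)

theorem Ent_measureLift
    (hm : ∀ g : G, m.map (fun x => g • x) = m) :
    Ent m (measureLift ν μ) = Ent (OrbitSpace.measure G m) μ := by
  by_cases h : μ ≪ OrbitSpace.measure G m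
  · have hent : ∀ f : ℝ → ℝ≥0∞, Measurable f →
        ∫⁻ x, f (entDensity m (measureLift ν μ) x) ∂m =
          ∫⁻ z, f (entDensity (OrbitSpace.measure G m) μ z) ∂(OrbitSpace.measure G m) := by
      intro f hf
      have hd : Measurable (entDensity (OrbitSpace.measure G m) μ) := by
        have := (Measure.measurable_rnDeriv μ (OrbitSpace.measure G m)).ennreal_toReal
        exact this.mul this.log
      have e : ∫⁻ z, f (entDensity (OrbitSpace.measure G m) μ z) ∂(OrbitSpace.measure G m) =
          ∫⁻ x, f (entDensity (OrbitSpace.measure G m) μ (proj G x)) ∂m :=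
        lintegral_map (hf.comp hd) measurable_proj
      rw [e]
      exact lintegral_congr_ae ((rnDeriv_measureLift (ν := ν) hm h).mono fun x hx => by
        simp only [entDensity, hx])
    have hneg := hent (fun r => ENNReal.ofReal (-r)) (by fun_prop)
    have hpos := hent ENNReal.ofReal (by fun_prop)
    rw [Ent, Ent, hneg, hpos, measureLift_absolutelyContinuous_iff hm]
  · rw [Ent, Ent, if_neg fun h' => h ((measureLift_absolutelyContinuous_iff (ν := ν) hm).1 h'.1),
      if_neg fun h' => h h'.1]

end OrbitSpace

theorem IsCoupling.isProbabilityMeasure {X : Type*} [MeasurableSpace X] {π : Measure (X × X)}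
    {μ μ' : Measure X} [IsProbabilityMeasure μ] (h : IsCoupling π μ μ') :
    IsProbabilityMeasure π := by
  constructor
  have h1 := h.1 ▸ measure_univ (μ := μ)
  rwa [Measure.map_apply measurable_fst MeasurableSet.univ, preimage_univ] at h1

namespace OrbitSpace

/-! ### Lifts of optimal transports -/

variable {G M : Type*} [Group G] [MulAction G M] [MetricSpace M] [IsIsometricSMul G M]
  [TopologicalSpace G] [CompactSpace G] [ContinuousOrbitMaps G M]

theorem edist_proj_le (x y : M) : edist (proj G x) (proj G y) ≤ edist x y := by
  rw [edist_dist, edist_dist]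
  exact ENNReal.ofReal_le_ofReal (dist_proj_le x y)

variable (G) in
-- `C` bounds the distance from `x₀` to points of its compact orbit; it lets second moments pass
-- from `M*` to `M`.
theorem exists_edist_le (x₀ : M) : ∃ C : ℝ≥0∞, C ≠ ∞ ∧
    ∀ x, edist x x₀ ≤ edist (proj G x) (proj G x₀) + C := by
  have hc : Continuous fun g : G => dist (g • x₀) x₀ :=
    (ContinuousOrbitMaps.continuous_orbitMap x₀).dist continuous_const
  obtain ⟨C, hC⟩ := (isCompact_range hc).bddAbove
  refine ⟨ENNReal.ofReal C, ENNReal.ofReal_ne_top, fun x => ?_⟩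
  obtain ⟨y, hy, hxy⟩ := exists_proj_eq_dist_eq x (proj G x₀)
  obtain ⟨g, rfl⟩ := proj_eq_iff.1 hy.symm
  refine (edist_triangle x (g • x₀) x₀).trans (add_le_add ?_ ?_)
  · rw [edist_dist, edist_dist, hxy]
  · rw [edist_dist]
    exact ENNReal.ofReal_le_ofReal (hC ⟨g, rfl⟩)

variable [MeasurableSpace M] [BorelSpace M]

theorem isCoupling_map_proj {π : Measure (M × M)} {κ κ' : Measure M} (h : IsCoupling π κ κ') :
    IsCoupling (π.map (Prod.map (proj G) (proj G))) (κ.map (proj G)) (κ'.map (proj G)) := by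
  have hp : Measurable (Prod.map (proj G) (proj G) : M × M → _) :=
    measurable_proj.prodMap measurable_proj
  constructor
  · rw [← h.1, Measure.map_map measurable_fst hp, Measure.map_map measurable_proj measurable_fst]
    rfl
  · rw [← h.2, Measure.map_map measurable_snd hp, Measure.map_map measurable_proj measurable_snd]
    rfl

variable [SecondCountableTopology M]

theorem cost_map_proj_le (π : Measure (M × M)) :
    cost (π.map (Prod.map (proj G) (proj G))) ≤ cost π := by
  rw [cost, lintegral_map (measurable_edist.pow_const 2) (measurable_proj.prodMap measurable_proj)]
  exact lintegral_mono fun z => pow_le_pow_left' (edist_proj_le _ _) 2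

variable [CompleteSpace M] [MeasurableSpace G] [BorelSpace G]
  {ν : Measure G} [IsProbabilityMeasure ν]
  {μ μ' : Measure (OrbitSpace G M)} [IsProbabilityMeasure μ]

theorem memP2_measureLift (h : MemP2 μ) : MemP2 (measureLift ν μ) := by
  refine ⟨isProbabilityMeasure_measureLift, ?_⟩
  obtain ⟨z, hz⟩ := h.moment
  obtain ⟨x₀, rfl⟩ := proj_surjective z
  obtain ⟨C, hC, hle⟩ := exists_edist_le G x₀
  refine ⟨x₀, ?_⟩
  have hprob : IsProbabilityMeasure (measureLift ν μ) := isProbabilityMeasure_measureLift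
  have hsq : ∀ a b : ℝ≥0∞, (a + b) ^ 2 ≤ 4 * a ^ 2 + 4 * b ^ 2 := fun a b => by
    have key : ∀ a b : ℝ≥0∞, a ≤ b → (a + b) ^ 2 ≤ 4 * b ^ 2 := fun a b hab => by
      calc (a + b) ^ 2 ≤ (b + b) ^ 2 := by gcongr
        _ = 4 * b ^ 2 := by ring
    rcases le_total a b with hab | hab
    · exact (key a b hab).trans le_add_self
    · rw [add_comm a b]
      exact (key b a hab).trans le_self_add
  have hm1 : Measurable fun z : OrbitSpace G M => edist z (proj G x₀) ^ 2 :=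
    (measurable_edist_left).pow_const 2
  calc ∫⁻ x, edist x x₀ ^ 2 ∂measureLift ν μ
      ≤ ∫⁻ x, (4 * edist (proj G x) (proj G x₀) ^ 2 + 4 * C ^ 2) ∂measureLift ν μ :=
        lintegral_mono fun x => (pow_le_pow_left' (hle x) 2).trans (hsq _ _)
    _ = 4 * ∫⁻ z, edist z (proj G x₀) ^ 2 ∂μ + 4 * C ^ 2 := by
        have hm2 : Measurable fun x : M => edist (proj G x) (proj G x₀) ^ 2 :=
          hm1.comp measurable_proj
        rw [lintegral_add_right _ measurable_const, lintegral_const_mul _ hm2,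
          lintegral_const, measure_univ, mul_one,
          ← lintegral_map (f := fun z => edist z (proj G x₀) ^ 2) hm1 measurable_proj,
          map_proj_measureLift]
    _ < ∞ := ENNReal.add_lt_top.2 ⟨ENNReal.mul_lt_top (by simp) hz,
        ENNReal.mul_lt_top (by simp) (ENNReal.pow_lt_top hC.lt_top)⟩

variable [ContinuousMul G] [ν.IsMulRightInvariant]

/-- The same `g` moves both points of a nearest pair, so averaging leaves the cost unchanged. -/
theorem exists_isCoupling_lift {π : Measure (OrbitSpace G M × OrbitSpace G M)}
    (h : IsCoupling π μ μ') : ∃ π' : Measure (M × M),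
      IsCoupling π' (measureLift ν μ) (measureLift ν μ') ∧ cost π' = cost π := by
  have := h.isProbabilityMeasure
  obtain ⟨s, hs, hps⟩ := exists_measurable_pair_lift (G := G) (M := M)
  refine ⟨haarLift ν s π, ⟨?_, ?_⟩, ?_⟩
  · rw [map_haarLift_equivariant hs measurable_fst fun _ _ => rfl,
      haarLift_eq_measureLift (measurable_fst.comp hs), ← h.1]
    exact congrArg (fun f => measureLift ν (π.map f)) (funext fun z => (hps z).1)
  · rw [map_haarLift_equivariant hs measurable_snd fun _ _ => rfl,
      haarLift_eq_measureLift (measurable_snd.comp hs), ← h.2]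
    exact congrArg (fun f => measureLift ν (π.map f)) (funext fun z => (hps z).2.1)
  · rw [cost, lintegral_haarLift hs (measurable_edist.pow_const 2), cost]
    refine lintegral_congr fun z => ?_
    simp only [Prod.smul_fst, Prod.smul_snd, edist_smul_left, lintegral_const, measure_univ, mul_one]
    rw [edist_dist, (hps z).2.2, ← edist_dist]

theorem W2_measureLift [IsProbabilityMeasure μ'] : W2 (measureLift ν μ) (measureLift ν μ') = W2 μ μ' := by
  rw [W2, W2]
  congr 1
  refine le_antisymm (le_iInf₂ fun π hπ => ?_) (le_iInf₂ fun π hπ => ?_)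
  · obtain ⟨π', h1, h2⟩ := exists_isCoupling_lift (ν := ν) hπ
    exact (iInf₂_le π' h1).trans_eq h2
  · have h := isCoupling_map_proj (G := G) hπ
    rw [map_proj_measureLift, map_proj_measureLift] at h
    exact (iInf₂_le (f := fun π (_ : π ∈ {π | IsCoupling π μ μ'}) => cost π) _ h).trans (cost_map_proj_le π)

theorem isW2Geodesic_measureLift {μ : I → Measure (OrbitSpace G M)} (h : IsW2Geodesic μ) :
    IsW2Geodesic fun t => measureLift ν (μ t) := by
  have := fun t => (h.memP2 t).prob
  exact ⟨fun t => memP2_measureLift (h.memP2 t), fun s t => by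
    rw [W2_measureLift, W2_measureLift, h.geodesic]⟩

/-- The plan is the average of a measurable horizontal lift of `P`. It is optimal because it costs
as much as `π`, while any competitor projects to a coupling of no greater cost, which is at least
that of `π`. -/
theorem exists_isInducedCoupling_lift {μ : I → Measure (OrbitSpace G M)}
    {π : Measure (OrbitSpace G M × OrbitSpace G M)} (h : IsInducedCoupling μ π) :
    ∃ π' : Measure (M × M), IsInducedCoupling (fun t => measureLift ν (μ t)) π' ∧
      π'.map (Prod.map (proj G) (proj G)) = π ∧
      ∀ᵐ z ∂π', dist z.1 z.2 = dist (proj G z.1) (proj G z.2) := by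
  obtain ⟨P, hP, hPμ, rfl, hopt⟩ := h
  obtain ⟨S, hS, hpS⟩ := exists_measurable_geo_lift (G := G) (M := M)
  have : PolishSpace (Geo M) := Geo.polishSpace
  have hprob : ∀ t, IsProbabilityMeasure (μ t) := fun t => by
    rw [← hPμ t]
    exact Measure.isProbabilityMeasure_map (Geo.continuous_eval t).measurable.aemeasurable
  have hends : Measurable fun γ : Geo M => (γ.eval 0, γ.eval 1) :=
    (Geo.continuous_eval 0).measurable.prodMk (Geo.continuous_eval 1).measurable
  have hends' : Measurable fun β : Geo (OrbitSpace G M) => (β.eval 0, β.eval 1) :=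
    (Geo.continuous_eval 0).measurable.prodMk (Geo.continuous_eval 1).measurable
  have hpp : Measurable (Prod.map (proj G) (proj G) : M × M → _) :=
    measurable_proj.prodMap measurable_proj
  set π' := (haarLift ν S P).map fun γ => (γ.eval 0, γ.eval 1)
  have heval : ∀ t, (haarLift ν S P).map (Geo.eval t) = measureLift ν (μ t) := fun t => by
    have ht : Measurable (Geo.eval t : Geo M → M) := (Geo.continuous_eval t).measurable
    rw [map_haarLift_equivariant hS ht fun _ _ => rfl,
      haarLift_eq_measureLift (ht.comp hS), ← hPμ t]
    exact congrArg (fun f => measureLift ν (P.map f)) (funext fun β => (hpS β).1 t)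
  have hmap : π'.map (Prod.map (proj G) (proj G)) = P.map fun β => (β.eval 0, β.eval 1) := by
    rw [Measure.map_map hpp hends]
    refine map_haarLift hS (hpp.comp hends) hends' fun g β => ?_
    simp only [Function.comp_apply, Geo.eval_smul, Prod.map_apply, proj_smul, (hpS β).1]
  have hdist : ∀ᵐ z ∂π', dist z.1 z.2 = dist (proj G z.1) (proj G z.2) := by
    have hcl : IsClosed {z : M × M | dist z.1 z.2 = dist (proj G z.1) (proj G z.2)} :=
      isClosed_eq (continuous_fst.dist continuous_snd)
        ((continuous_proj.comp continuous_fst).dist (continuous_proj.comp continuous_snd))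
    refine (ae_map_iff hends.aemeasurable hcl.measurableSet).2 ?_
    refine (ae_map_iff (measurable_smul_comp hS).aemeasurable
      (hends hcl.measurableSet)).2 (Filter.Eventually.of_forall fun z => ?_)
    change dist (z.1 • (S z.2).eval 0) (z.1 • (S z.2).eval 1) =
      dist (proj G (z.1 • (S z.2).eval 0)) (proj G (z.1 • (S z.2).eval 1))
    simp only [proj_smul, dist_smul, (hpS z.2).1, (hpS z.2).2]
  have hcost : cost π' = cost (P.map fun β => (β.eval 0, β.eval 1)) := by
    rw [← hmap, cost, cost, lintegral_map (measurable_edist.pow_const 2) hpp]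
    refine lintegral_congr_ae (hdist.mono fun z hz => ?_)
    simp only [edist_dist, hz, Prod.map_fst, Prod.map_snd]
  refine ⟨π', ⟨haarLift ν S P, isProbabilityMeasure_haarLift hS, heval, rfl, ⟨?_, ?_⟩, ?_⟩,
    hmap, hdist⟩
  · rw [Measure.map_map measurable_fst hends]
    exact heval 0
  · rw [Measure.map_map measurable_snd hends]
    exact heval 1
  · intro κ hκ
    have h := isCoupling_map_proj (G := G) hκ
    rw [map_proj_measureLift, map_proj_measureLift] at h
    exact hcost.trans_le ((hopt.2 _ h).trans (cost_map_proj_le κ))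

/-! ### The curvature-dimension conditions on the orbit space -/

variable {m : Measure M} [SigmaFinite m]

theorem memP2ac_measureLift (hm : ∀ g : G, m.map (fun x => g • x) = m)
    (h : MemP2ac (OrbitSpace.measure G m) μ) : MemP2ac m (measureLift ν μ) :=
  ⟨memP2_measureLift h.1, (measureLift_absolutelyContinuous_iff hm).2 h.2⟩

/-- The coefficient `β` depends on the points only through their distance, so a single argument
serves `CD` and `CD*`. -/
theorem strongDistortion_measure (ν : Measure G) [IsProbabilityMeasure ν]
    [ν.IsMulRightInvariant] (hm : ∀ g : G, m.map (fun x => g • x) = m) {N : ℝ}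
    {β : ℝ → ℝ → ℝ → ℝ≥0∞} (H : StrongDistortion m N β) :
    StrongDistortion (OrbitSpace.measure G m) N β := by
  intro μ hμ h0 h1
  have hprob := fun t => (hμ.memP2 t).prob
  obtain ⟨hac, hineq⟩ := H _ (isW2Geodesic_measureLift (ν := ν) hμ)
    (memP2ac_measureLift hm h0) (memP2ac_measureLift hm h1)
  have hac' : ∀ t, μ t ≪ OrbitSpace.measure G m := fun t =>
    (measureLift_absolutelyContinuous_iff hm).1 (hac t).2
  refine ⟨fun t => ⟨hμ.memP2 t, hac' t⟩, fun π hπ t N' hN' => ?_⟩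
  obtain ⟨π', hπ', rfl, hdist⟩ := exists_isInducedCoupling_lift (ν := ν) hπ
  rw [← renyi_measureLift (ν := ν) hm (hac' t)]
  refine le_trans ?_ (hineq π' hπ' t N' hN')
  obtain ⟨-, -, -, -, ⟨hfst, hsnd⟩, -⟩ := hπ'
  have hr : ∀ t, ∀ᵐ x ∂measureLift ν (μ t), (measureLift ν (μ t)).rnDeriv m x =
      (μ t).rnDeriv (OrbitSpace.measure G m) (proj G x) := fun t =>
    (hac t).2.ae_le (rnDeriv_measureLift (ν := ν) hm (hac' t))
  have hr0 := ae_of_ae_map measurable_fst.aemeasurable 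
    ((Measure.absolutelyContinuous_of_eq hfst).ae_le (hr 0))
  have hr1 := ae_of_ae_map measurable_snd.aemeasurable 
    ((Measure.absolutelyContinuous_of_eq hsnd).ae_le (hr 1))
  -- Only this inequality of the change of variables is needed, and it holds without measurability
  -- of `β`.
  refine (lintegral_map_le _ _).trans_eq (lintegral_congr_ae ?_)
  filter_upwards [hdist, hr0, hr1] with z hz hz0 hz1
  simp only [Prod.map_fst, Prod.map_snd, ← hz]
  rw [hz0, hz1]

/-- No coupling appears in this condition: preservation of entropy and `W₂` suffices. -/
theorem strongCDInfty_measure (ν : Measure G) [IsProbabilityMeasure ν]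
    [ν.IsMulRightInvariant] (hm : ∀ g : G, m.map (fun x => g • x) = m) {K : ℝ}
    (H : StrongCDInfty m K) : StrongCDInfty (OrbitSpace.measure G m) K := by
  intro μ hμ h0 h1 he0 he1 t
  have hprob := fun t => (hμ.memP2 t).prob
  have h := H _ (isW2Geodesic_measureLift (ν := ν) hμ)
    (memP2ac_measureLift hm h0) (memP2ac_measureLift hm h1)
  simp only [Ent_measureLift hm, W2_measureLift] at h
  exact h he0 he1 t

theorem isMMSpace_measure (ν : Measure G) [IsProbabilityMeasure ν]
    [ν.IsMulRightInvariant] (hM : IsMMSpace m) (hm : ∀ g : G, m.map (fun x => g • x) = m) :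
    IsMMSpace (OrbitSpace.measure G m) where
  complete := completeSpace
  separable := separableSpace
  geodesic := exists_geo hM.geodesic
  sigmaFinite := sigmaFinite_measure ν hm
  fullSupport :=
    have := hM.fullSupport
    continuous_proj.isOpenPosMeasure_map proj_surjective

end OrbitSpace

end QuotCD

end

theorem theorem3p5 {M G : Type*}
    [MetricSpace M] [MeasurableSpace M] [BorelSpace M]
    [Group G] [TopologicalSpace G] [IsTopologicalGroup G] [CompactSpace G]
    [MulAction G M] [IsIsometricSMul G M] [QuotCD.ContinuousOrbitMaps G M]
    (m : Measure M) (hM : QuotCD.IsMMSpace m)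
    (hm : ∀ g : G, m.map (fun x => g • x) = m)
    (K N : ℝ) (hN : 1 ≤ N) :
    QuotCD.IsMMSpace (QuotCD.OrbitSpace.measure G m) ∧
    (QuotCD.StrongCD m K N → QuotCD.StrongCD (QuotCD.OrbitSpace.measure G m) K N) ∧
    (QuotCD.StrongCDStar m K N → QuotCD.StrongCDStar (QuotCD.OrbitSpace.measure G m) K N) ∧
    (QuotCD.StrongCDInfty m K → QuotCD.StrongCDInfty (QuotCD.OrbitSpace.measure G m) K) := by
  have := hM.complete
  have := hM.separable
  have := hM.sigmaFinite
  have : SecondCountableTopology M := UniformSpace.secondCountable_of_separable M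
  borelize G
  obtain ⟨ν, hν, hν'⟩ := QuotCD.exists_isMulRightInvariant_isProbabilityMeasure G
  exact ⟨QuotCD.OrbitSpace.isMMSpace_measure ν hM hm,
    QuotCD.OrbitSpace.strongDistortion_measure ν hm,
    QuotCD.OrbitSpace.strongDistortion_measure ν hm,
    QuotCD.OrbitSpace.strongCDInfty_measure ν hm⟩
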